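/- For $n\ge 0$, $\mathbf k=(k_1,\dots,k_n)\in\mathbb Z_{\ge1}^n$, $\mathbf l=(l_1,\dots,l_n)\in\mathbb Z_{\ge0}^n$ with $k_u-1-l_u\ge0$ for all $u$, and $\sigma\in\mathbb R$, let $$\mathrm{Ls}_{\mathbf k}^{\mathbf l}(\sigma)=(-1)^n\int_0^\sigma\int_0^{\theta_n}\cdots\int_0^{\theta_2}\prod_{u=1}^n\theta_u^{l_u}A(\theta_u)^{k_u-1-l_u}\,d\theta_1\cdots d\theta_n,\qquad A(\theta)=\log|2\sin(\theta/2)|,$$ with value $1$ for $n=0$. An index $\mathbf h=(h_1,\dots,h_d)$ ($d\ge0$) of positive integers is admissible if $d=0$ or $h_d\ge2$; for such $\mathbf h$ and $|z|\le1$ put $$\mathrm{Li}_{\mathbf h}(z)=\sum_{0<m_1<\cdots<m_d}\frac{z^{m_d}}{m_1^{h_1}\cdots m_d^{h_d}},\qquad \zeta(\mathbf h)=\sum_{0<m_1<\cdots<m_d}\frac{1}{m_1^{h_1}\cdots m_d^{h_d}},$$ both equal to $1$ for $d=0$. **Theorem.** Let $n,\mathbf k,\mathbf l$ be as above. (1)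 For every integer $m\ge0$ and each choice of sign, the function $\sigma\mapsto\mathrm{Ls}_{\mathbf k}^{\mathbf l}(\pm(2m\pi+\sigma))$ on $[0,2\pi]$ is a finite $\mathbb Q(i)$-linear combination, with coefficients independent of $\sigma$, of functions of the form $$\sigma\mapsto\sigma^a\,\pi^b\,\zeta(\mathbf h^{(1)})\cdots\zeta(\mathbf h^{(r)})\,\mathrm{Li}_{\mathbf g^{(1)}}(e^{i\sigma})\cdots\mathrm{Li}_{\mathbf g^{(s)}}(e^{i\sigma}),$$ where $a,b,r,s\ge0$ are integers and all $\mathbf h^{(j)},\mathbf g^{(j)}$ are admissible indices. (2) For every $m\in\mathbb Z$, $\mathrm{Ls}_{\mathbf k}^{\mathbf l}(2m\pi)$ lies in the $\mathbb Q$-subalgebra of $\mathbb R$ generated by $\pi$ and all multiple zeta values $\zeta(\mathbf h)$, $\mathbf h$ admissible. -/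

import Mathlib

open scoped IntermediateField

noncomputable section

/-- The iterated integral
`∫_0^σ ∫_0^{θ_n} ⋯ ∫_0^{θ_2} f_1(θ_1) ⋯ f_n(θ_n) dθ_1 ⋯ dθ_n`
(the outermost variable is the last one); it is `1` for `n = 0`. -/
def iteratedIntegral : (n : ℕ) → (Fin n → ℝ → ℝ) → ℝ → ℝ
  | 0, _, _ => 1
  | n + 1, f, σ =>
      ∫ θ in (0 : ℝ)..σ, f (Fin.last n) θ * iteratedIntegral n (Fin.init f) θ

/-- `A(θ) = log |2 sin (θ/2)|`. -/
def logSineA (θ : ℝ) : ℝ := Real.log |2 * Real.sin (θ / 2)|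

/-- The iterated log-sine integral `Ls_k^l(σ)`; the exponent `k_u - 1 - l_u` is an integer. -/
def iteratedLogSine {n : ℕ} (k l : Fin n → ℕ) (σ : ℝ) : ℝ :=
  (-1) ^ n *
    iteratedIntegral n (fun u θ => θ ^ l u * logSineA θ ^ ((k u : ℤ) - 1 - (l u : ℤ))) σ

/-- An admissible index `(k_1, …, k_n)`: positive integers with `k_n ≥ 2`; `n = 0` is allowed. -/
structure AdmissibleIndex where
  /-- the depth `n` -/
  depth : ℕ
  /-- the entries `k_1, …, k_n` -/
  entry : Fin depth → ℕ
  one_le : ∀ u, 1 ≤ entry u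
  two_le_last : ∀ u : Fin depth, (u : ℕ) + 1 = depth → 2 ≤ entry u

/-- The index set of the nested sums: tuples `0 < m_1 < ⋯ < m_n`. -/
def IncreasingTuple (n : ℕ) : Type :=
  {m : Fin n → ℕ // StrictMono m ∧ ∀ u, 0 < m u}

/-- The multiple zeta value `ζ(k_1, …, k_n) = ∑_{0 < m_1 < ⋯ < m_n} ∏ m_u ^ (-k_u)`.
For `n = 0` the only tuple is the empty one and the value is `1`. -/
def multipleZeta (k : AdmissibleIndex) : ℝ :=
  ∑' m : IncreasingTuple k.depth, 1 / ∏ u, (m.1 u : ℝ) ^ k.entry u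

/-- The nested series `Li_k(z) = ∑_{0 < m_1 < ⋯ < m_n} z ^ m_n / ∏ m_u ^ k_u`, `1` for `n = 0`. -/
def polylogSeries : (n : ℕ) → (Fin n → ℕ) → ℂ → ℂ
  | 0, _, _ => 1
  | n + 1, k, z =>
      ∑' m : IncreasingTuple (n + 1), z ^ m.1 (Fin.last n) / ∏ u, (m.1 u : ℂ) ^ k u

/-- The multiple polylogarithm `Li_k(z)` of an admissible index `k`, for `|z| ≤ 1`. -/
def multiplePolylog (k : AdmissibleIndex) (z : ℂ) : ℂ := polylogSeries k.depth k.entry z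

/-- The function
`σ ↦ σ^a π^b ζ(k⁽¹⁾) ⋯ ζ(k⁽ʳ⁾) Li_{h⁽¹⁾}(e^{iσ}) ⋯ Li_{h⁽ˢ⁾}(e^{iσ})` on `[0, 2π]`. -/
def logSineProduct (a b : ℕ) (zs ls : List AdmissibleIndex) :
    Set.Icc (0 : ℝ) (2 * Real.pi) → ℂ := fun σ =>
  ((σ : ℝ) : ℂ) ^ a * (Real.pi : ℂ) ^ b *
    (zs.map fun k => (multipleZeta k : ℂ)).prod *
    (ls.map fun h => multiplePolylog h (Complex.exp (Complex.I * ((σ : ℝ) : ℂ)))).prod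

/-- All `ℚ(i)`-linear combinations of the products above, as functions of `σ ∈ [0, 2π]`. -/
def logSineSpan : Submodule ℚ⟮Complex.I⟯ (Set.Icc (0 : ℝ) (2 * Real.pi) → ℂ) :=
  Submodule.span ℚ⟮Complex.I⟯
    {f | ∃ (a b : ℕ) (zs ls : List AdmissibleIndex), f = logSineProduct a b zs ls}

end

/-!
On `(0, 2π)` one has `log |2 sin (θ/2)| = -Li_1(e^{iθ}) + i (π - θ) / 2`, so an iterated log-sine
integral is an iterated integral of powers of `θ` and of `Li_1(e^{iθ})`. Two facts keep these inside
the span of the functions `θ^a π^b ζ(k⁽¹⁾) ⋯ ζ(k⁽ʳ⁾) Li_k(e^{iθ})` with at most one polylogarithm.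

* Multiplication by `Li_1` is the shuffle product with a word of one letter: `Li_1 · Li_w` is the sum
  of the `Li_{w'}` over all insertions of the letter `1` into the word `w` of `Li_w`
  (`PolylogWord.series_one_mul`).
* `d/dθ Li_{0w}(e^{iθ}) = i Li_w(e^{iθ})`, where `0w` is always admissible. Integration by parts
  then evaluates `∫_0^σ θ^a Li_w(e^{iθ}) dθ`; the boundary terms at `θ = 0` are the multiple zeta
  values `Li_{0w}(1)` (`exists_tendsto_integral_pow_mul_series`).

The intermediate words `w` need not be admissible, and their series need not converge absolutely on
the unit circle. Both facts are therefore used on circles of radius `r_N < 1`, where everything is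
a power series, and the limit `r_N → 1` is taken only for the integrals: on the side of the
primitives only admissible words remain, and on the side of the integrands dominated convergence
applies, the majorant being a power of `|log |2 sin (θ/2)||` plus a constant
(`exists_boundarySpan_integral`).

Periodicity of the kernel reduces `2mπ + σ` to `σ ∈ [0, 2π]`, by induction on `m`; parity reduces
negative arguments to positive ones. At `σ = 0` the polylogarithms become multiple zeta values, and
the real part of a `ℚ(i)`-combination of these is a `ℚ`-combination, which gives the statement on
the values at `2mπ`.
-/

noncomputable section

/-! ### Words and their coefficients -/

lemma sum_range_inv_sqrt_le (m : ℕ) :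
    ∑ j ∈ Finset.range (m + 1), (√(j : ℝ))⁻¹ ≤ 2 * √(m : ℝ) := by
  induction m with
  | zero => simp
  | succ m ih =>
    rw [Finset.sum_range_succ]
    have h0 : (0 : ℝ) < √((m : ℝ) + 1) := Real.sqrt_pos.2 (by positivity)
    have h1 : √(m : ℝ) ^ 2 = m := Real.sq_sqrt (by positivity)
    have h2 : √((m : ℝ) + 1) ^ 2 = m + 1 := Real.sq_sqrt (by positivity)
    have h3 : (√((m : ℝ) + 1))⁻¹ ≤ 2 * √((m : ℝ) + 1) - 2 * √(m : ℝ) := by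
      rw [inv_le_iff_one_le_mul₀ h0]
      nlinarith [sq_nonneg (√((m : ℝ) + 1) - √(m : ℝ))]
    push_cast
    linarith

/-- A nonempty word in the letters `0` and `1` whose innermost letter is `1`; it encodes the index
`(h_1, …, h_d)` as `0^{h_d - 1} 1 ⋯ 0^{h_1 - 1} 1`, the last entry `h_d` being outermost. The
admissible words are those of the form `zero w`. -/
inductive PolylogWord where
  /-- the word `1` -/
  | one : PolylogWord
  /-- the letter `0` in front of `w`: the last entry of the index grows by one -/
  | zero (w : PolylogWord) : PolylogWord
  /-- the letter `1` in front of `w`: a last entry `1` is appended to the index -/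
  | cons (w : PolylogWord) : PolylogWord

namespace PolylogWord

/-- The coefficient of `z ^ m` in `Li_w(z)`; at `m = 0` it vanishes because division by zero gives
zero. -/
def coeff : PolylogWord → ℕ → ℝ
  | one, m => 1 / m
  | zero w, m => coeff w m / m
  | cons w, m => (∑ j ∈ Finset.range m, coeff w j) / m

@[simp]
lemma coeff_at_zero (w : PolylogWord) : w.coeff 0 = 0 := by
  cases w <;> simp [coeff]

lemma coeff_nonneg (w : PolylogWord) (m : ℕ) : 0 ≤ w.coeff m := by
  induction w generalizing m with
  | one => simp only [coeff]; positivity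
  | zero w ih => exact div_nonneg (ih m) m.cast_nonneg
  | cons w ih => exact div_nonneg (Finset.sum_nonneg fun j _ => ih j) m.cast_nonneg

/-- Each letter `1` takes an average of `m` coefficients and each letter `0` divides by `m ≥ 1`. -/
lemma coeff_le_one (w : PolylogWord) (m : ℕ) : w.coeff m ≤ 1 := by
  rcases Nat.eq_zero_or_pos m with rfl | hm
  · simp
  have hm1 : (1 : ℝ) ≤ m := by exact_mod_cast hm
  induction w generalizing m with
  | one => exact div_le_one_of_le₀ hm1 (by positivity)
  | zero w ih => exact div_le_one_of_le₀ ((ih m hm hm1).trans hm1) (by positivity)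
  | cons w ih =>
    refine div_le_one_of_le₀ ?_ (by positivity)
    calc ∑ j ∈ Finset.range m, w.coeff j ≤ ∑ _j ∈ Finset.range m, (1 : ℝ) := by
          refine Finset.sum_le_sum fun j _ => ?_
          rcases Nat.eq_zero_or_pos j with rfl | hj
          · simp
          · exact ih j hj (by exact_mod_cast hj)
      _ = m := by simp

/-- A decay rate that prepending `1` preserves up to a factor `2`, and which after division by `m`
is summable. -/
lemma exists_coeff_le (w : PolylogWord) : ∃ C : ℝ, 0 ≤ C ∧ ∀ m, w.coeff m ≤ C * (√(m : ℝ))⁻¹ := by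
  have key : ∀ (m : ℕ) (x : ℝ), 0 ≤ x → x / (m : ℝ) ≤ x * (√(m : ℝ))⁻¹ := by
    intro m x hx
    rcases Nat.eq_zero_or_pos m with rfl | hm
    · simp
    have hm1 : (1 : ℝ) ≤ m := by exact_mod_cast hm
    rw [div_eq_mul_inv]
    gcongr
    exact Real.sqrt_le_self_iff.2 (Or.inr hm1)
  induction w with
  | one => exact ⟨1, zero_le_one, fun m => key m 1 zero_le_one⟩
  | zero w _ =>
    refine ⟨1, zero_le_one, fun m => (key m _ (coeff_nonneg w m)).trans ?_⟩
    gcongr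
    exact coeff_le_one w m
  | cons w ih =>
    obtain ⟨C, hC, h⟩ := ih
    refine ⟨2 * C, by positivity, fun m => ?_⟩
    rcases Nat.eq_zero_or_pos m with rfl | hm
    · simp
    have hm0 : (0 : ℝ) < m := by exact_mod_cast hm
    have hs : (0 : ℝ) < √(m : ℝ) := Real.sqrt_pos.2 hm0
    have h1 : ∑ j ∈ Finset.range m, w.coeff j ≤ C * (2 * √(m : ℝ)) := by
      calc ∑ j ∈ Finset.range m, w.coeff j ≤ ∑ j ∈ Finset.range m, C * (√(j : ℝ))⁻¹ :=
            Finset.sum_le_sum fun j _ => h j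
        _ ≤ ∑ j ∈ Finset.range (m + 1), C * (√(j : ℝ))⁻¹ :=
            Finset.sum_le_sum_of_subset_of_nonneg (Finset.range_mono m.le_succ)
              fun _ _ _ => by positivity
        _ = C * ∑ j ∈ Finset.range (m + 1), (√(j : ℝ))⁻¹ := by rw [Finset.mul_sum]
        _ ≤ C * (2 * √(m : ℝ)) := by gcongr; exact sum_range_inv_sqrt_le m
    calc (∑ j ∈ Finset.range m, w.coeff j) / m ≤ C * (2 * √(m : ℝ)) / m := by gcongr
      _ = 2 * C * (√(m : ℝ))⁻¹ := by
        have := Real.sq_sqrt hm0.le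
        field_simp
        rw [this]

lemma summable_coeff_zero (w : PolylogWord) : Summable (zero w).coeff := by
  obtain ⟨C, hC, h⟩ := exists_coeff_le w
  have hs : Summable fun m : ℕ => C * ((m : ℝ) ^ (3 / 2 : ℝ))⁻¹ :=
    (Real.summable_nat_rpow_inv.2 (by norm_num)).mul_left C
  refine Summable.of_nonneg_of_le (coeff_nonneg _) (fun m => ?_) hs
  rcases Nat.eq_zero_or_pos m with rfl | hm
  · simp
  have hm0 : (0 : ℝ) < m := by exact_mod_cast hm
  have e : (m : ℝ) ^ (3 / 2 : ℝ) = √(m : ℝ) * m := by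
    rw [Real.sqrt_eq_rpow, ← Real.rpow_add_one hm0.ne']
    norm_num
  calc w.coeff m / m ≤ C * (√(m : ℝ))⁻¹ / m := by gcongr; exact h m
    _ = C * ((m : ℝ) ^ (3 / 2 : ℝ))⁻¹ := by rw [e, mul_inv]; ring

/-! ### Shuffle product with the letter `1` -/

/-- All words obtained by inserting one letter `1` into the given word, with multiplicity: the
shuffle product of the words `1` and `w`. -/
def insertOne : PolylogWord → List PolylogWord
  | one => [cons one, cons one]
  | zero w => cons (zero w) :: (insertOne w).map zero
  | cons w => cons (cons w) :: (insertOne w).map cons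

/-- `Li_w` as a formal power series. -/
def formal (w : PolylogWord) : PowerSeries ℝ := PowerSeries.mk w.coeff

@[simp]
lemma constantCoeff_formal (w : PolylogWord) : PowerSeries.constantCoeff w.formal = 0 := by
  simp [formal, ← PowerSeries.coeff_zero_eq_constantCoeff_apply]

open PowerSeries in
lemma X_mul_derivative_zero (w : PolylogWord) : X * d⁄dX ℝ (zero w).formal = w.formal := by
  ext m
  cases m with
  | zero => simp
  | succ m =>
    rw [coeff_succ_X_mul, coeff_derivative]
    simp only [formal, coeff_mk, PolylogWord.coeff]
    push_cast
    field_simp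

open PowerSeries in
lemma derivative_one : d⁄dX ℝ one.formal = mk 1 := by
  ext m
  rw [coeff_derivative]
  simp only [formal, coeff_mk, PolylogWord.coeff, Pi.one_apply]
  push_cast
  field_simp

open PowerSeries in
lemma derivative_cons (w : PolylogWord) : d⁄dX ℝ (cons w).formal = mk 1 * w.formal := by
  ext m
  rw [coeff_derivative, mul_comm (mk 1), coeff_mul, Finset.Nat.sum_antidiagonal_eq_sum_range_succ_mk]
  simp only [formal, coeff_mk, PolylogWord.coeff, Pi.one_apply, mul_one]
  push_cast
  field_simp

open PowerSeries in
lemma eq_of_X_mul_derivative_eq {f g : PowerSeries ℝ} (hD : X * d⁄dX ℝ f = X * d⁄dX ℝ g)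
    (hc : constantCoeff f = constantCoeff g) : f = g :=
  derivative.ext (mul_left_cancel₀ X_ne_zero hD) hc

open PowerSeries in
/-- The shuffle product with the one-letter word `1`: by induction on the word, both sides have the
same derivative and no constant term. -/
lemma formal_one_mul (w : PolylogWord) :
    one.formal * w.formal = (w.insertOne.map formal).sum := by
  have hc (l : List PolylogWord) : constantCoeff (l.map formal).sum = 0 := by
    induction l with
    | nil => simp
    | cons a l ih => simp [ih]
  induction w with
  | one =>
    refine derivative.ext ?_ (by simp [hc])
    simp [insertOne, derivative_one, derivative_cons, mul_comm]
  | zero w ih =>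
    have hz (l : List PolylogWord) :
        X * d⁄dX ℝ ((l.map zero).map formal).sum = (l.map formal).sum := by
      induction l with
      | nil => simp
      | cons a l ih => simp_all [mul_add, X_mul_derivative_zero]
    refine eq_of_X_mul_derivative_eq ?_ (by simp [hc])
    simp only [insertOne, List.map_cons, List.sum_cons, map_add, mul_add, hz, ← ih, derivative_cons,
      Derivation.leibniz, smul_eq_mul, derivative_one]
    linear_combination one.formal * X_mul_derivative_zero w
  | cons w ih =>
    have hz (l : List PolylogWord) :
        d⁄dX ℝ ((l.map cons).map formal).sum = mk 1 * (l.map formal).sum := by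
      induction l with
      | nil => simp
      | cons a l ih => simp_all [mul_add, derivative_cons]
    refine derivative.ext ?_ (by simp [hc])
    simp only [insertOne, List.map_cons, List.sum_cons, map_add, hz, ← ih, derivative_cons,
      Derivation.leibniz, smul_eq_mul, derivative_one]
    ring

/-! ### The functions defined by words -/

/-- The function `Li_w(z) = ∑ m, coeff w m * z ^ m`. It is used for `|z| < 1`, and for `|z| ≤ 1`
when `w` begins with the letter `0`. -/
def series (w : PolylogWord) (z : ℂ) : ℂ := ∑' m : ℕ, (w.coeff m : ℂ) * z ^ m

lemma norm_coeff_mul_pow_le (w : PolylogWord) (z : ℂ) (m : ℕ) :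
    ‖(w.coeff m : ℂ) * z ^ m‖ ≤ ‖z‖ ^ m := by
  rw [norm_mul, norm_pow, Complex.norm_real, Real.norm_of_nonneg (coeff_nonneg w m)]
  exact mul_le_of_le_one_left (by positivity) (coeff_le_one w m)

lemma summable_norm_series (w : PolylogWord) {z : ℂ} (hz : ‖z‖ < 1) :
    Summable fun m : ℕ => ‖(w.coeff m : ℂ) * z ^ m‖ :=
  Summable.of_nonneg_of_le (fun _ => norm_nonneg _) (norm_coeff_mul_pow_le w z)
    (summable_geometric_of_lt_one (norm_nonneg z) hz)

lemma series_one {z : ℂ} (hz : ‖z‖ < 1) : one.series z = -Complex.log (1 - z) := by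
  rw [← (Complex.hasSum_taylorSeries_neg_log hz).tsum_eq]
  refine tsum_congr fun m => ?_
  simp only [coeff]
  push_cast
  ring

lemma series_one_mul (w : PolylogWord) {z : ℂ} (hz : ‖z‖ < 1) :
    one.series z * w.series z = (w.insertOne.map fun v => v.series z).sum := by
  have hcoeff (m : ℕ) : ∑ p ∈ Finset.HasAntidiagonal.antidiagonal m, one.coeff p.1 * w.coeff p.2 =
      (w.insertOne.map fun v => v.coeff m).sum := by
    have h := congrArg (PowerSeries.coeff m) (formal_one_mul w)
    rw [PowerSeries.coeff_mul, map_list_sum, List.map_map] at h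
    simpa [formal, Function.comp_def] using h
  have hsum (l : List PolylogWord) :
      HasSum (fun m : ℕ => (((l.map fun v => v.coeff m).sum : ℝ) : ℂ) * z ^ m)
        (l.map fun v => v.series z).sum := by
    induction l with
    | nil => simp
    | cons v l ih =>
      have hv : HasSum (fun m : ℕ => (v.coeff m : ℂ) * z ^ m) (v.series z) :=
        (summable_norm_series v hz).of_norm.hasSum
      simpa [add_mul] using hv.add ih
  rw [series, series, tsum_mul_tsum_eq_tsum_sum_antidiagonal_of_summable_norm
    (summable_norm_series one hz) (summable_norm_series w hz), ← (hsum w.insertOne).tsum_eq]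
  refine tsum_congr fun m => ?_
  rw [← hcoeff, Complex.ofReal_sum, Finset.sum_mul]
  refine Finset.sum_congr rfl fun p hp => ?_
  rw [← Finset.HasAntidiagonal.mem_antidiagonal.1 hp, pow_add]
  push_cast
  ring

lemma hasDerivAt_series_zero (w : PolylogWord) {r : ℝ} (h0 : 0 ≤ r) (h1 : r < 1) (θ : ℝ) :
    HasDerivAt (fun t : ℝ => (zero w).series (r * Complex.exp (Complex.I * t)))
      (Complex.I * w.series (r * Complex.exp (Complex.I * θ))) θ := by
  have hn (t : ℝ) : ‖(r : ℂ) * Complex.exp (Complex.I * t)‖ = r := by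
    rw [norm_mul, mul_comm Complex.I, Complex.norm_exp_ofReal_mul_I, Complex.norm_real,
      Real.norm_of_nonneg h0, mul_one]
  unfold series
  rw [← tsum_mul_left]
  refine hasDerivAt_tsum
    (g := fun (m : ℕ) (t : ℝ) => ((zero w).coeff m : ℂ) * (r * Complex.exp (Complex.I * t)) ^ m)
    (g' := fun (m : ℕ) (t : ℝ) =>
      Complex.I * ((w.coeff m : ℂ) * (r * Complex.exp (Complex.I * t)) ^ m))
    (summable_geometric_of_lt_one h0 h1) (fun m t => ?_) (fun m t => ?_)
    (y₀ := 0) ?_ θ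
  · have hexp : HasDerivAt (fun t : ℝ => (r : ℂ) * Complex.exp (Complex.I * t))
        (r * (Complex.exp (Complex.I * t) * Complex.I)) t := by
      have := ((hasDerivAt_id (t : ℂ)).const_mul Complex.I).cexp.comp_ofReal
      simpa using this.const_mul (r : ℂ)
    refine ((hexp.pow m).const_mul ((zero w).coeff m : ℂ)).congr_deriv ?_
    rcases m with _ | m
    · simp
    · simp only [coeff]
      push_cast
      have : (m : ℂ) + 1 ≠ 0 := by exact_mod_cast m.succ_ne_zero
      field_simp
      rw [pow_succ]
      ring
  · rw [norm_mul, Complex.norm_I, one_mul]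
    exact (norm_coeff_mul_pow_le w _ m).trans_eq (by rw [hn])
  · exact (summable_norm_series _ (by rwa [hn])).of_norm

lemma norm_series_zero_le (w : PolylogWord) {z : ℂ} (hz : ‖z‖ ≤ 1) :
    ‖(zero w).series z‖ ≤ ∑' m, (zero w).coeff m := by
  refine tsum_of_norm_bounded (summable_coeff_zero w).hasSum fun m => ?_
  rw [norm_mul, norm_pow, Complex.norm_real, Real.norm_of_nonneg (coeff_nonneg _ m)]
  exact mul_le_of_le_one_right (coeff_nonneg _ m) (pow_le_one₀ (norm_nonneg z) hz)

lemma continuousOn_series_zero (w : PolylogWord) :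
    ContinuousOn (zero w).series (Metric.closedBall 0 1) := by
  refine continuousOn_tsum (fun m => by fun_prop) (summable_coeff_zero w) fun m z hz => ?_
  rw [norm_mul, norm_pow, Complex.norm_real, Real.norm_of_nonneg (coeff_nonneg _ m)]
  exact mul_le_of_le_one_right (coeff_nonneg _ m)
    (pow_le_one₀ (norm_nonneg z) (by simpa using hz))

lemma continuousOn_series (w : PolylogWord) : ContinuousOn w.series (Metric.ball 0 1) := by
  refine fun z hz => ContinuousAt.continuousWithinAt ?_
  have hz : ‖z‖ < 1 := by simpa using hz
  obtain ⟨ρ, h1, h2⟩ := exists_between hz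
  have : ContinuousOn w.series (Metric.closedBall 0 ρ) := by
    refine continuousOn_tsum (fun m => by fun_prop)
      (summable_geometric_of_lt_one ((norm_nonneg z).trans h1.le) h2) fun m y hy => ?_
    refine (norm_coeff_mul_pow_le w y m).trans ?_
    gcongr
    simpa using hy
  exact this.continuousAt (Metric.closedBall_mem_nhds_of_mem (by simpa using h1))

end PolylogWord

/-! ### Nested sums -/

open Classical in
/-- The increasing tuples `0 < m_1 < ⋯ < m_n < M`. -/
def boundedTuples (n M : ℕ) : Finset (Fin n → ℕ) :=
  (Fintype.piFinset fun _ => Finset.range M).filter fun t => StrictMono t ∧ ∀ u, 0 < t u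

lemma mem_boundedTuples {n M : ℕ} {t : Fin n → ℕ} :
    t ∈ boundedTuples n M ↔ (∀ u, t u < M) ∧ StrictMono t ∧ ∀ u, 0 < t u := by
  simp [boundedTuples]

lemma strictMono_snoc {n : ℕ} {t : Fin n → ℕ} {j : ℕ} (ht : StrictMono t) (hj : ∀ u, t u < j) :
    StrictMono (Fin.snoc t j : Fin (n + 1) → ℕ) := by
  intro u v huv
  induction v using Fin.lastCases with
  | last =>
    induction u using Fin.lastCases with
    | last => exact absurd huv (lt_irrefl _)
    | cast u => simpa using hj u
  | cast v =>
    induction u using Fin.lastCases with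
    | last => exact absurd huv (not_lt.2 (Fin.le_last _))
    | cast u => simpa using ht (by simpa using huv)

/-- An increasing tuple of length `n + 1` is its last entry `j` together with an increasing tuple
of length `n` with entries below `j`. -/
def increasingTupleEquiv (n : ℕ) :
    IncreasingTuple (n + 1) ≃ Σ j : {j : ℕ // 0 < j}, boundedTuples n j where
  toFun t := ⟨⟨t.1 (Fin.last n), t.2.2 _⟩, ⟨Fin.init t.1, mem_boundedTuples.2
    ⟨fun u => t.2.1 (Fin.castSucc_lt_last u),
      fun _ _ h => t.2.1 (Fin.castSucc_lt_castSucc_iff.2 h), fun u => t.2.2 _⟩⟩⟩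
  invFun p := ⟨Fin.snoc p.2.1 p.1.1,
    strictMono_snoc (mem_boundedTuples.1 p.2.2).2.1 (mem_boundedTuples.1 p.2.2).1, fun u => by
      induction u using Fin.lastCases with
      | last => simpa using p.1.2
      | cast u => simpa using (mem_boundedTuples.1 p.2.2).2.2 u⟩
  left_inv t := Subtype.ext (Fin.snoc_init_self t.1)
  right_inv p := by
    refine Sigma.subtype_ext (Subtype.ext ?_) ?_
    · simp
    · simp

/-- The truncated multiple zeta value: the sum over `0 < m_1 < ⋯ < m_n < M` when all exponents are
positive (`nestedSum_eq`). The index `0` occurs in the range of summation but contributes nothing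
for positive exponents. -/
def nestedSum : (n : ℕ) → (Fin n → ℕ) → ℕ → ℝ
  | 0, _, _ => 1
  | n + 1, k, M => ∑ j ∈ Finset.range M, nestedSum n (Fin.init k) j * (1 / (j : ℝ) ^ k (Fin.last n))

lemma nestedSum_eq (n : ℕ) (k : Fin n → ℕ) (hk : ∀ u, 1 ≤ k u) (M : ℕ) :
    nestedSum n k M = ∑ t ∈ boundedTuples n M, 1 / ∏ u, (t u : ℝ) ^ k u := by
  induction n generalizing M with
  | zero =>
    have : boundedTuples 0 M = Finset.univ := Finset.eq_univ_of_forall fun t =>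
      mem_boundedTuples.2 ⟨fun u => u.elim0, Subsingleton.strictMono t, fun u => u.elim0⟩
    simp [nestedSum, this]
  | succ n ih =>
    have h0 : nestedSum (n + 1) k M = ∑ j ∈ (Finset.range M).filter (0 < ·),
        nestedSum n (Fin.init k) j * (1 / (j : ℝ) ^ k (Fin.last n)) := by
      refine (Finset.sum_filter_of_ne fun j _ hj => ?_).symm
      rcases Nat.eq_zero_or_pos j with rfl | h
      · have := hk (Fin.last n)
        simp [show k (Fin.last n) ≠ 0 by omega] at hj
      · exact h
    rw [h0]
    have h1 : ∀ j, nestedSum n (Fin.init k) j * (1 / (j : ℝ) ^ k (Fin.last n)) =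
        ∑ t ∈ boundedTuples n j, (1 / ∏ u, (t u : ℝ) ^ Fin.init k u) *
          (1 / (j : ℝ) ^ k (Fin.last n)) := by
      intro j
      rw [ih (Fin.init k) (fun u => hk _) j, Finset.sum_mul]
    simp_rw [h1]
    rw [Finset.sum_sigma']
    refine Finset.sum_bij' (fun p _ => (Fin.snoc p.2 p.1 : Fin (n + 1) → ℕ))
      (fun t _ => ⟨t (Fin.last n), Fin.init t⟩) ?_ ?_ ?_ ?_ ?_
    · rintro ⟨j, t⟩ h
      simp only [Finset.mem_sigma, Finset.mem_filter, Finset.mem_range, mem_boundedTuples] at h ⊢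
      refine ⟨fun u => ?_, strictMono_snoc h.2.2.1 h.2.1, fun u => ?_⟩
      · induction u using Fin.lastCases with
        | last => simpa using h.1.1
        | cast u => simpa using (h.2.1 u).trans h.1.1
      · induction u using Fin.lastCases with
        | last => simpa using h.1.2
        | cast u => simpa using h.2.2.2 u
    · intro t h
      simp only [Finset.mem_sigma, Finset.mem_filter, Finset.mem_range, mem_boundedTuples] at h ⊢
      exact ⟨⟨h.1 _, h.2.2 _⟩, fun u => h.2.1 (Fin.castSucc_lt_last u),
        fun _ _ huv => h.2.1 (Fin.castSucc_lt_castSucc_iff.2 huv), fun u => h.2.2 _⟩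
    · rintro ⟨j, t⟩ h
      simp
    · intro t h
      simp
    · rintro ⟨j, t⟩ h
      rw [Fin.prod_univ_castSucc]
      simp [Fin.init, mul_comm]

/-- The nested series, summed over the inner variables first, is a power series in `z`. -/
lemma tsum_increasingTuple (n : ℕ) (k : Fin (n + 1) → ℕ) (hk : ∀ u, 1 ≤ k u)
    (hs : Summable fun m : ℕ => nestedSum n (Fin.init k) m / (m : ℝ) ^ k (Fin.last n))
    {z : ℂ} (hz : ‖z‖ ≤ 1) :
    ∑' t : IncreasingTuple (n + 1), z ^ t.1 (Fin.last n) / ∏ u, (t.1 u : ℂ) ^ k u =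
      ∑' m : ℕ, ((nestedSum n (Fin.init k) m / (m : ℝ) ^ k (Fin.last n) : ℝ) : ℂ) * z ^ m := by
  set g : (Σ j : {j : ℕ // 0 < j}, boundedTuples n j) → ℝ := fun p =>
    (1 / ∏ u, (p.2.1 u : ℝ) ^ Fin.init k u) * (1 / ((p.1 : ℕ) : ℝ) ^ k (Fin.last n)) with hg
  have hfib (j : {j : ℕ // 0 < j}) : ∑ t : boundedTuples n j, g ⟨j, t⟩ =
      nestedSum n (Fin.init k) j / ((j : ℕ) : ℝ) ^ k (Fin.last n) := by
    rw [nestedSum_eq n (Fin.init k) (fun u => hk _), div_eq_mul_one_div, Finset.sum_mul,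
      ← Finset.sum_coe_sort (boundedTuples n j)]
  have hg0 : 0 ≤ g := fun p => by simp only [hg, Pi.zero_apply]; positivity
  have hgs : Summable g := by
    refine (summable_sigma_of_nonneg hg0).2 ⟨fun j => Summable.of_finite, ?_⟩
    simp_rw [tsum_fintype, hfib]
    exact hs.comp_injective Subtype.val_injective
  have hgc : Summable fun p => (g p : ℂ) * z ^ (p.1 : ℕ) := by
    refine Summable.of_norm_bounded hgs fun p => ?_
    rw [norm_mul, norm_pow, Complex.norm_real, Real.norm_of_nonneg (hg0 p)]
    exact mul_le_of_le_one_right (hg0 p) (pow_le_one₀ (norm_nonneg z) hz)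
  calc ∑' t : IncreasingTuple (n + 1), z ^ t.1 (Fin.last n) / ∏ u, (t.1 u : ℂ) ^ k u
      = ∑' t : IncreasingTuple (n + 1),
          (g (increasingTupleEquiv n t) : ℂ) * z ^ ((increasingTupleEquiv n t).1 : ℕ) := by
        refine tsum_congr fun t => ?_
        have hgt : g (increasingTupleEquiv n t) =
            (1 / ∏ u : Fin n, (t.1 u.castSucc : ℝ) ^ k u.castSucc) *
              (1 / (t.1 (Fin.last n) : ℝ) ^ k (Fin.last n)) := rfl
        have hlast : ((increasingTupleEquiv n t).1 : ℕ) = t.1 (Fin.last n) := rfl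
        rw [Fin.prod_univ_castSucc, hgt, hlast]
        push_cast
        rw [div_mul_div_comm, one_mul, one_div_mul_eq_div]
    _ = ∑' p, (g p : ℂ) * z ^ (p.1 : ℕ) :=
        (increasingTupleEquiv n).tsum_eq fun p => (g p : ℂ) * z ^ (p.1 : ℕ)
    _ = ∑' j : {j : ℕ // 0 < j}, ((nestedSum n (Fin.init k) j /
          ((j : ℕ) : ℝ) ^ k (Fin.last n) : ℝ) : ℂ) * z ^ (j : ℕ) := by
        rw [hgc.tsum_sigma]
        refine tsum_congr fun j => ?_
        rw [tsum_fintype, ← hfib, Complex.ofReal_sum, Finset.sum_mul]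
    _ = _ := by
        refine tsum_subtype_eq_of_support_subset (s := {j : ℕ | 0 < j}) (f := fun m : ℕ =>
          ((nestedSum n (Fin.init k) m / (m : ℝ) ^ k (Fin.last n) : ℝ) : ℂ) * z ^ m) fun m hm => ?_
        rcases Nat.eq_zero_or_pos m with rfl | h
        · have := hk (Fin.last n)
          simp [show k (Fin.last n) ≠ 0 by omega] at hm
        · exact h

namespace PolylogWord

/-- Every word comes from an index of positive integers. Prepending `0` raises the last entry, and
prepending `1` appends a new last entry `1`. -/
lemma exists_index (w : PolylogWord) : ∃ (n : ℕ) (k : Fin (n + 1) → ℕ), (∀ u, 1 ≤ k u) ∧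
    ∀ m : ℕ, w.coeff m = nestedSum n (Fin.init k) m / (m : ℝ) ^ k (Fin.last n) := by
  induction w with
  | one => exact ⟨0, fun _ => 1, fun _ => le_rfl, fun m => by simp [coeff, nestedSum]⟩
  | zero w ih =>
    obtain ⟨n, k, hk, h⟩ := ih
    refine ⟨n, Fin.snoc (Fin.init k) (k (Fin.last n) + 1), fun u => ?_, fun m => ?_⟩
    · induction u using Fin.lastCases with
      | last => simp
      | cast u => simpa [Fin.init] using hk u.castSucc
    · rw [coeff, h]
      simp [pow_succ, div_div]
  | cons w ih =>
    obtain ⟨n, k, hk, h⟩ := ih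
    refine ⟨n + 1, Fin.snoc k 1, fun u => ?_, fun m => ?_⟩
    · induction u using Fin.lastCases with
      | last => simp
      | cast u => simpa using hk u
    · simp [coeff, nestedSum, h, div_eq_mul_inv]

lemma exists_admissibleIndex (w : PolylogWord) : ∃ h : AdmissibleIndex,
    (∀ z : ℂ, ‖z‖ ≤ 1 → multiplePolylog h z = (zero w).series z) ∧
    (multipleZeta h : ℂ) = (zero w).series 1 := by
  obtain ⟨n, k, hk, h⟩ := exists_index w
  set k' : Fin (n + 1) → ℕ := Fin.snoc (Fin.init k) (k (Fin.last n) + 1) with hk'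
  have h1 : ∀ u, 1 ≤ k' u := fun u => by
    induction u using Fin.lastCases with
    | last => simp [hk']
    | cast u => simpa [hk', Fin.init] using hk u.castSucc
  have hc (m : ℕ) : nestedSum n (Fin.init k') m / (m : ℝ) ^ k' (Fin.last n) =
      (zero w).coeff m := by
    rw [coeff, h]
    simp [hk', pow_succ, div_div]
  have hs : Summable fun m : ℕ => nestedSum n (Fin.init k') m / (m : ℝ) ^ k' (Fin.last n) := by
    simp_rw [hc]
    exact summable_coeff_zero w
  have key (z : ℂ) (hz : ‖z‖ ≤ 1) := tsum_increasingTuple n k' h1 hs hz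
  simp_rw [hc] at key
  refine ⟨⟨n + 1, k', h1, fun u hu => ?_⟩, key, ?_⟩
  · obtain rfl : u = Fin.last n := Fin.ext (by simpa using hu)
    have := hk (Fin.last n)
    simp only [hk', Fin.snoc_last]
    omega
  · rw [series, ← key 1 (by simp), multipleZeta, Complex.ofReal_tsum]
    refine tsum_congr fun t => ?_
    push_cast
    simp

end PolylogWord

/-! ### The log-sine kernel -/

open MeasureTheory Filter Topology

lemma measurable_logSineA : Measurable logSineA := by
  unfold logSineA
  fun_prop

lemma logSineA_neg (θ : ℝ) : logSineA (-θ) = logSineA θ := by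
  simp [logSineA, neg_div]

lemma periodic_logSineA : Function.Periodic logSineA (2 * Real.pi) := by
  intro θ
  have : (θ + 2 * Real.pi) / 2 = θ / 2 + Real.pi := by ring
  simp [logSineA, this, Real.sin_add_pi]

lemma logSineA_add_nat_mul (m : ℕ) (θ : ℝ) : logSineA (2 * m * Real.pi + θ) = logSineA θ := by
  rw [← (periodic_logSineA.nat_mul m) θ]
  ring_nf

/-- The logarithmic singularity at `0`, in a form that majorizes all powers of the kernel at once. -/
lemma exp_abs_logSineA_le {θ : ℝ} (h0 : 0 < θ) (hπ : θ ≤ Real.pi) :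
    Real.exp (|logSineA θ| / 2) ≤ Real.exp (1 / 2) * (θ ^ (-1 / 2 : ℝ) + 1) := by
  have hsin : 2 / Real.pi * (θ / 2) ≤ Real.sin (θ / 2) :=
    Real.mul_le_sin (by linarith) (by linarith)
  have hpos : 0 < 2 / Real.pi * (θ / 2) := by positivity
  have hx : 0 < 2 * Real.sin (θ / 2) := by linarith
  have hA : logSineA θ = Real.log (2 * Real.sin (θ / 2)) := by rw [logSineA, abs_of_pos hx]
  have hup : logSineA θ ≤ 1 := by
    rw [hA]
    have := Real.log_le_sub_one_of_pos hx
    linarith [Real.sin_le_one (θ / 2)]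
  have hlow : Real.log θ - 1 ≤ logSineA θ := by
    have h1 : Real.log (θ * (2 / Real.pi)) ≤ logSineA θ := by
      rw [hA]
      refine Real.log_le_log (by positivity) ?_
      linarith
    rw [Real.log_mul h0.ne' (by positivity)] at h1
    have h2 : Real.log (Real.pi / 2) ≤ 1 := by
      have := Real.log_le_sub_one_of_pos (x := Real.pi / 2) (by positivity)
      linarith [Real.pi_le_four]
    have h3 : Real.log (2 / Real.pi) = -Real.log (Real.pi / 2) := by
      rw [← Real.log_inv, inv_div]
    linarith
  have hexp : Real.exp (1 / 2) * θ ^ (-1 / 2 : ℝ) = Real.exp ((1 - Real.log θ) / 2) := by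
    rw [Real.rpow_def_of_pos h0, ← Real.exp_add]
    ring_nf
  rw [mul_add, mul_one, hexp]
  rcases abs_cases (logSineA θ) with ⟨h, _⟩ | ⟨h, _⟩ <;> rw [h]
  · have : Real.exp (logSineA θ / 2) ≤ Real.exp (1 / 2) := Real.exp_le_exp.2 (by linarith)
    linarith [Real.exp_pos ((1 - Real.log θ) / 2)]
  · have : Real.exp (-logSineA θ / 2) ≤ Real.exp ((1 - Real.log θ) / 2) :=
      Real.exp_le_exp.2 (by linarith)
    linarith [Real.exp_pos (1 / 2)]

lemma intervalIntegrable_abs_logSineA_pow (p : ℕ) (a b : ℝ) :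
    IntervalIntegrable (fun θ => |logSineA θ| ^ p) volume a b := by
  have h0 : IntervalIntegrable (fun θ => |logSineA θ| ^ p) volume 0 Real.pi := by
    have hg : IntervalIntegrable (fun θ : ℝ => p.factorial * 2 ^ p *
        (Real.exp (1 / 2) * (θ ^ (-1 / 2 : ℝ) + 1))) volume 0 Real.pi :=
      (((intervalIntegral.intervalIntegrable_rpow' (by norm_num)).add
        intervalIntegrable_const).const_mul _).const_mul _
    refine hg.mono_fun' (measurable_logSineA.abs.pow_const p).aestronglyMeasurable ?_
    refine (ae_restrict_iff' measurableSet_uIoc).2 (Eventually.of_forall fun θ hθ => ?_)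
    rw [Set.uIoc_of_le Real.pi_pos.le] at hθ
    -- `x ^ p ≤ p! exp x` with `x = |A| / 2`; the factor `1/2` leaves the integrable `θ ^ (-1/2)`.
    have h1 := Real.pow_div_factorial_le_exp (|logSineA θ| / 2) (by positivity) p
    have h2 := h1.trans (exp_abs_logSineA_le hθ.1 hθ.2)
    dsimp only
    rw [div_le_iff₀ (by positivity), div_pow, div_le_iff₀ (by positivity)] at h2
    rw [Real.norm_of_nonneg (by positivity)]
    linarith
  have h1 : IntervalIntegrable (fun θ => |logSineA θ| ^ p) volume (-Real.pi) 0 := by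
    have := ((IntervalIntegrable.iff_comp_neg (by simp)).1 h0).symm
    simpa [logSineA_neg] using this
  have hper : Function.Periodic (fun θ => |logSineA θ| ^ p) (2 * Real.pi) := fun θ => by
    simp only [periodic_logSineA θ]
  -- One period centred at the singularity `0`, so that parity covers its left half.
  refine hper.intervalIntegrable (t := -Real.pi) (by positivity) ?_ a b
  have : -Real.pi + 2 * Real.pi = Real.pi := by ring
  rw [this]
  exact h1.trans h0

lemma intervalIntegrable_continuous_mul_logSineA_pow {f : ℝ → ℝ} (hf : Continuous f) (p : ℕ)
    (a b : ℝ) : IntervalIntegrable (fun θ => f θ * logSineA θ ^ p) volume a b := by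
  have h : IntervalIntegrable (fun θ => logSineA θ ^ p) volume a b := by
    refine (intervalIntegrable_abs_logSineA_pow p a b).mono_fun
      (measurable_logSineA.pow_const p).aestronglyMeasurable (Eventually.of_forall fun θ => ?_)
    simp
  exact h.continuousOn_mul hf.continuousOn

/-! ### Approximation of the kernel from inside the unit disc -/

/-- Radii `r_N = 1 - 1 / (N + 1)` in `[0, 1)` that tend to `1`. -/
def radius (N : ℕ) : ℝ := 1 - 1 / ((N : ℝ) + 1)

lemma radius_nonneg (N : ℕ) : 0 ≤ radius N := by
  have h : 1 / ((N : ℝ) + 1) ≤ 1 := div_le_one_of_le₀ (by simp) (by positivity)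
  unfold radius
  linarith

lemma radius_lt_one (N : ℕ) : radius N < 1 := by
  have h : 0 < 1 / ((N : ℝ) + 1) := by positivity
  unfold radius
  linarith

lemma tendsto_radius : Tendsto radius atTop (𝓝 1) := by
  have h := (tendsto_one_div_add_atTop_nhds_zero_nat (𝕜 := ℝ)).const_sub 1
  rwa [sub_zero] at h

/-- The point `r_N e^{iθ}`. -/
def circlePoint (N : ℕ) (θ : ℝ) : ℂ := radius N * Complex.exp (Complex.I * θ)

lemma norm_circlePoint (N : ℕ) (θ : ℝ) : ‖circlePoint N θ‖ = radius N := by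
  rw [circlePoint, norm_mul, Complex.norm_exp_I_mul_ofReal, Complex.norm_real,
    Real.norm_of_nonneg (radius_nonneg N), mul_one]

lemma norm_circlePoint_lt_one (N : ℕ) (θ : ℝ) : ‖circlePoint N θ‖ < 1 :=
  (norm_circlePoint N θ).trans_lt (radius_lt_one N)

lemma tendsto_circlePoint (θ : ℝ) :
    Tendsto (fun N => circlePoint N θ) atTop (𝓝 (Complex.exp (Complex.I * θ))) := by
  have h : Tendsto (fun N => (radius N : ℂ)) atTop (𝓝 ((1 : ℝ) : ℂ)) :=
    (Complex.continuous_ofReal.tendsto 1).comp tendsto_radius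
  simpa [circlePoint] using h.mul_const (Complex.exp (Complex.I * θ))

lemma continuous_circlePoint (N : ℕ) : Continuous (circlePoint N) := by
  unfold circlePoint
  fun_prop

namespace PolylogWord

lemma continuous_series_circlePoint (w : PolylogWord) (N : ℕ) :
    Continuous fun θ => w.series (circlePoint N θ) :=
  (continuousOn_series w).comp_continuous (continuous_circlePoint N) fun θ => by
    simpa using norm_circlePoint_lt_one N θ

lemma tendsto_series_zero_circlePoint (w : PolylogWord) (θ : ℝ) :
    Tendsto (fun N => (zero w).series (circlePoint N θ)) atTop
      (𝓝 ((zero w).series (Complex.exp (Complex.I * θ)))) := by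
  have h := (continuousOn_series_zero w) (Complex.exp (Complex.I * θ))
    (by simp [Complex.norm_exp_I_mul_ofReal])
  exact h.tendsto.comp (tendsto_nhdsWithin_iff.2 ⟨tendsto_circlePoint θ,
    Eventually.of_forall fun N => by simpa using (norm_circlePoint_lt_one N θ).le⟩)

end PolylogWord

/-- The approximation `log (1 - r_N e^{iθ}) + i (π - θ) / 2` of `log |2 sin (θ/2)|`, written with
`Li_1`. -/
def logSineApprox (N : ℕ) (θ : ℝ) : ℂ :=
  -PolylogWord.one.series (circlePoint N θ) + Complex.I * ((Real.pi - θ) / 2)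

lemma logSineApprox_eq (N : ℕ) (θ : ℝ) :
    logSineApprox N θ = Complex.log (1 - circlePoint N θ) + Complex.I * ((Real.pi - θ) / 2) := by
  rw [logSineApprox, PolylogWord.series_one (norm_circlePoint_lt_one N θ), neg_neg]

/-- The polar form `1 - e^{iθ} = 2 sin (θ/2) e^{i (θ - π) / 2}`. -/
lemma one_sub_exp_I_mul (θ : ℝ) : 1 - Complex.exp (Complex.I * θ) =
    ((2 * Real.sin (θ / 2) : ℝ) : ℂ) * Complex.exp (((θ - Real.pi) / 2 : ℝ) * Complex.I) := by
  have h1 : Complex.exp (Complex.I * θ) =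
      Complex.exp ((θ / 2 : ℝ) * Complex.I) * Complex.exp ((θ / 2 : ℝ) * Complex.I) := by
    rw [← Complex.exp_add]
    push_cast
    ring_nf
  have h2 : Complex.exp (((θ - Real.pi) / 2 : ℝ) * Complex.I) =
      Complex.exp ((θ / 2 : ℝ) * Complex.I) * -Complex.I := by
    have : (((θ - Real.pi) / 2 : ℝ) : ℂ) * Complex.I =
        ((θ / 2 : ℝ) : ℂ) * Complex.I + -Real.pi / 2 * Complex.I := by push_cast; ring
    rw [this, Complex.exp_add, Complex.exp_neg_pi_div_two_mul_I]
  rw [h1, h2, Complex.exp_mul_I, ← Complex.ofReal_cos, ← Complex.ofReal_sin]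
  have h3 : ((Real.sin (θ / 2) : ℝ) : ℂ) ^ 2 + ((Real.cos (θ / 2) : ℝ) : ℂ) ^ 2 = 1 := by
    exact_mod_cast Real.sin_sq_add_cos_sq (θ / 2)
  push_cast at h3 ⊢
  linear_combination (-1 : ℂ) * h3 + (Complex.sin (θ / 2)) ^ 2 * Complex.I_sq

lemma log_one_sub_exp_I_mul {θ : ℝ} (h0 : 0 < θ) (h1 : θ < 2 * Real.pi) :
    Complex.log (1 - Complex.exp (Complex.I * θ)) + Complex.I * ((Real.pi - θ) / 2) =
      (logSineA θ : ℂ) := by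
  have hpos : 0 < 2 * Real.sin (θ / 2) :=
    mul_pos two_pos (Real.sin_pos_of_pos_of_lt_pi (by linarith) (by linarith))
  rw [one_sub_exp_I_mul, Complex.log_ofReal_mul hpos (Complex.exp_ne_zero _), Complex.log_exp,
    logSineA, abs_of_pos hpos]
  · push_cast
    ring
  · simp only [Complex.mul_I_im, Complex.ofReal_re]
    linarith
  · simp only [Complex.mul_I_im, Complex.ofReal_re]
    linarith

lemma tendsto_logSineApprox {θ : ℝ} (h0 : 0 < θ) (h1 : θ < 2 * Real.pi) :
    Tendsto (fun N => logSineApprox N θ) atTop (𝓝 (logSineA θ : ℂ)) := by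
  rw [← log_one_sub_exp_I_mul h0 h1]
  simp_rw [logSineApprox_eq]
  refine Tendsto.add_const _ (((tendsto_circlePoint θ).const_sub 1).clog ?_)
  refine Or.inl ?_
  have hcos : Real.cos θ ≠ 1 := fun h =>
    h0.ne' ((Real.cos_eq_one_iff_of_lt_of_lt (by linarith [Real.pi_pos]) h1).1 h)
  have := lt_of_le_of_ne (Real.cos_le_one θ) hcos
  rw [Complex.sub_re, Complex.one_re, mul_comm, Complex.exp_ofReal_mul_I_re]
  linarith

/-- A bound uniform in the radius. It rests on `|1 - r e^{iθ}| ≥ |1 - e^{iθ}| / 2`, which holds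
because `|1 - e^{iθ}| ≤ |1 - r e^{iθ}| + (1 - r)` and `1 - r ≤ |1 - r e^{iθ}|`. The constant covers
`log 2`, the argument of `1 - r e^{iθ}` and the linear term. -/
lemma norm_logSineApprox_le (N : ℕ) {θ : ℝ} (h0 : 0 < θ) (h1 : θ < 2 * Real.pi) :
    ‖logSineApprox N θ‖ ≤ |logSineA θ| + 10 := by
  have hpos : 0 < 2 * Real.sin (θ / 2) :=
    mul_pos two_pos (Real.sin_pos_of_pos_of_lt_pi (by linarith) (by linarith))
  set z := circlePoint N θ with hz
  have he : ‖1 - Complex.exp (Complex.I * θ)‖ = 2 * Real.sin (θ / 2) := by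
    rw [norm_sub_rev, Complex.norm_exp_I_mul_ofReal_sub_one, Real.norm_of_nonneg hpos.le]
  have hzlt : ‖z‖ < 1 := norm_circlePoint_lt_one N θ
  have hr : 1 - radius N ≤ ‖1 - z‖ := by
    have := norm_sub_norm_le 1 z
    rwa [hz, norm_circlePoint, norm_one, ← hz] at this
  have hd : ‖z - Complex.exp (Complex.I * θ)‖ = 1 - radius N := by
    have : z - Complex.exp (Complex.I * θ) =
        ((radius N - 1 : ℝ) : ℂ) * Complex.exp (Complex.I * θ) := by
      rw [hz, circlePoint]; push_cast; ring
    rw [this, norm_mul, Complex.norm_exp_I_mul_ofReal, Complex.norm_real, mul_one,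
      Real.norm_eq_abs, abs_sub_comm, abs_of_nonneg (by linarith [radius_lt_one N])]
  have hlow : Real.sin (θ / 2) ≤ ‖1 - z‖ := by
    have := norm_add_le (1 - z) (z - Complex.exp (Complex.I * θ))
    rw [sub_add_sub_cancel, he, hd] at this
    linarith
  have hup : ‖1 - z‖ ≤ 2 := by
    have := norm_sub_le 1 z
    rw [norm_one] at this
    linarith
  have hs : 0 < Real.sin (θ / 2) := by linarith
  have hA : logSineA θ = Real.log 2 + Real.log (Real.sin (θ / 2)) := by
    rw [logSineA, abs_of_pos hpos, Real.log_mul two_ne_zero hs.ne']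
  have hlog2 : Real.log 2 ≤ 1 := by
    have := Real.log_le_sub_one_of_pos (x := 2) two_pos
    linarith
  have hre : |(Complex.log (1 - z)).re| ≤ |logSineA θ| + 1 := by
    rw [Complex.log_re, abs_le]
    have g1 := Real.log_le_log hs hlow
    have g2 := Real.log_le_log (hs.trans_le hlow) hup
    have g3 := neg_abs_le (logSineA θ)
    have g4 := abs_nonneg (logSineA θ)
    constructor <;> linarith
  have him : |(Complex.log (1 - z)).im| ≤ Real.pi := by
    rw [Complex.log_im]
    exact Complex.abs_arg_le_pi _
  have hlin : ‖Complex.I * (((Real.pi : ℂ) - θ) / 2)‖ ≤ Real.pi / 2 := by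
    rw [show Complex.I * (((Real.pi : ℂ) - θ) / 2) = Complex.I * (((Real.pi - θ) / 2 : ℝ) : ℂ) by
      push_cast; ring, norm_mul, Complex.norm_I, one_mul, Complex.norm_real, Real.norm_eq_abs, abs_le]
    constructor <;> linarith
  rw [logSineApprox_eq]
  have := norm_add_le (Complex.log (1 - z)) (Complex.I * (((Real.pi : ℂ) - θ) / 2))
  have := Complex.norm_le_abs_re_add_abs_im (Complex.log (1 - z))
  linarith [Real.pi_le_four]

/-! ### Spans of products of powers, constants and polylogarithms -/

open PolylogWord

/-- The constant `π^b ζ(k⁽¹⁾) ⋯ ζ(k⁽ʳ⁾)`. -/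
def zetaMonomial (b : ℕ) (zs : List AdmissibleIndex) : ℂ :=
  (Real.pi : ℂ) ^ b * (zs.map fun k => (multipleZeta k : ℂ)).prod

/-- `Li_w(z)`, with `none` standing for the empty word, whose polylogarithm is `1`. -/
def seriesOrOne : Option PolylogWord → ℂ → ℂ
  | none, _ => 1
  | some w, z => w.series z

/-- The `ℚ(i)`-span of the functions `θ^a π^b ζ(k⁽¹⁾) ⋯ ζ(k⁽ʳ⁾) Li_w(r_N e^{iθ})` of `N` and `θ`,
with `w` an arbitrary word, possibly empty. -/
def innerSpan : Submodule ℚ⟮Complex.I⟯ (ℕ → ℝ → ℂ) :=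
  Submodule.span ℚ⟮Complex.I⟯ {Φ | ∃ (a b : ℕ) (zs : List AdmissibleIndex) (o : Option PolylogWord),
    Φ = fun N (θ : ℝ) => (θ : ℂ) ^ a * zetaMonomial b zs * seriesOrOne o (circlePoint N θ)}

/-- The `ℚ(i)`-span of the functions `θ^a π^b ζ(k⁽¹⁾) ⋯ ζ(k⁽ʳ⁾) Li_w(e^{iθ})` of `θ`, with `w`
empty or admissible. -/
def boundarySpan : Submodule ℚ⟮Complex.I⟯ (ℝ → ℂ) :=
  Submodule.span ℚ⟮Complex.I⟯ {f | ∃ (a b : ℕ) (zs : List AdmissibleIndex) (o : Option PolylogWord),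
    f = fun θ : ℝ => (θ : ℂ) ^ a * zetaMonomial b zs *
      seriesOrOne (o.map zero) (Complex.exp (Complex.I * θ))}

/-- The imaginary unit as an element of `ℚ(i)`. -/
def gaussianI : ℚ⟮Complex.I⟯ := ⟨Complex.I, IntermediateField.mem_adjoin_simple_self ℚ Complex.I⟩

lemma gaussianI_smul (z : ℂ) : gaussianI • z = Complex.I * z := rfl

lemma mul_mem_span_of_forall {K A : Type*} [CommSemiring K] [CommSemiring A] [Algebra K A]
    {S : Set A} {x f : A} (h : ∀ s ∈ S, x * s ∈ Submodule.span K S)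
    (hf : f ∈ Submodule.span K S) : x * f ∈ Submodule.span K S := by
  induction hf using Submodule.span_induction with
  | mem s hs => exact h s hs
  | zero => simp
  | add f g _ _ hf hg => rw [mul_add]; exact add_mem hf hg
  | smul c f _ hf => rw [mul_smul_comm]; exact Submodule.smul_mem _ c hf

lemma zetaMonomial_mul (b b' : ℕ) (zs zs' : List AdmissibleIndex) :
    zetaMonomial b zs * zetaMonomial b' zs' = zetaMonomial (b + b') (zs ++ zs') := by
  simp only [zetaMonomial, List.map_append, List.prod_append]
  ring

lemma mem_innerSpan (a b : ℕ) (zs : List AdmissibleIndex) (o : Option PolylogWord) :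
    (fun N (θ : ℝ) => (θ : ℂ) ^ a * zetaMonomial b zs * seriesOrOne o (circlePoint N θ)) ∈ innerSpan :=
  Submodule.subset_span ⟨a, b, zs, o, rfl⟩

lemma mem_boundarySpan (a b : ℕ) (zs : List AdmissibleIndex) (o : Option PolylogWord) :
    (fun θ : ℝ => (θ : ℂ) ^ a * zetaMonomial b zs *
      seriesOrOne (o.map zero) (Complex.exp (Complex.I * θ))) ∈ boundarySpan :=
  Submodule.subset_span ⟨a, b, zs, o, rfl⟩

lemma monomial_mul_mem_innerSpan (a b : ℕ) (zs : List AdmissibleIndex) {Φ : ℕ → ℝ → ℂ}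
    (hΦ : Φ ∈ innerSpan) :
    (fun N (θ : ℝ) => (θ : ℂ) ^ a * zetaMonomial b zs * Φ N θ) ∈ innerSpan := by
  refine mul_mem_span_of_forall (x := fun _ (θ : ℝ) => (θ : ℂ) ^ a * zetaMonomial b zs) ?_ hΦ
  rintro _ ⟨a', b', zs', o, rfl⟩
  change _ ∈ innerSpan
  convert mem_innerSpan (a + a') (b + b') (zs ++ zs') o using 1
  funext N θ
  simp only [Pi.mul_apply, ← zetaMonomial_mul]
  ring

lemma monomial_mul_mem_boundarySpan (a b : ℕ) (zs : List AdmissibleIndex) {f : ℝ → ℂ}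
    (hf : f ∈ boundarySpan) :
    (fun θ : ℝ => (θ : ℂ) ^ a * zetaMonomial b zs * f θ) ∈ boundarySpan := by
  refine mul_mem_span_of_forall (x := fun θ : ℝ => (θ : ℂ) ^ a * zetaMonomial b zs) ?_ hf
  rintro _ ⟨a', b', zs', o, rfl⟩
  change _ ∈ boundarySpan
  convert mem_boundarySpan (a + a') (b + b') (zs ++ zs') o using 1
  funext θ
  simp only [Pi.mul_apply, ← zetaMonomial_mul]
  ring

lemma mul_mem_innerSpan {Φ : ℕ → ℝ → ℂ} (hΦ : Φ ∈ innerSpan) :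
    (fun N (θ : ℝ) => (θ : ℂ) * Φ N θ) ∈ innerSpan := by
  simpa [zetaMonomial] using monomial_mul_mem_innerSpan 1 0 [] hΦ

lemma pi_mul_mem_innerSpan {Φ : ℕ → ℝ → ℂ} (hΦ : Φ ∈ innerSpan) :
    (fun N (θ : ℝ) => (Real.pi : ℂ) * Φ N θ) ∈ innerSpan := by
  simpa [zetaMonomial] using monomial_mul_mem_innerSpan 0 1 [] hΦ

lemma series_one_mul_mem_innerSpan {Φ : ℕ → ℝ → ℂ} (hΦ : Φ ∈ innerSpan) :
    (fun N (θ : ℝ) => one.series (circlePoint N θ) * Φ N θ) ∈ innerSpan := by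
  refine mul_mem_span_of_forall (x := fun N θ => one.series (circlePoint N θ)) ?_ hΦ
  rintro _ ⟨a, b, zs, o, rfl⟩
  change _ ∈ innerSpan
  cases o with
  | none =>
    convert mem_innerSpan a b zs (some one) using 1
    funext N θ
    simp only [Pi.mul_apply, seriesOrOne]
    ring
  | some w =>
    have hl (l : List PolylogWord) : (fun N (θ : ℝ) => (θ : ℂ) ^ a * zetaMonomial b zs *
        (l.map fun v => v.series (circlePoint N θ)).sum) ∈ innerSpan := by
      induction l with
      | nil =>
        simp only [List.map_nil, List.sum_nil, mul_zero]
        exact zero_mem _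
      | cons v l ih =>
        simp only [List.map_cons, List.sum_cons, mul_add]
        exact add_mem (mem_innerSpan a b zs (some v)) ih
    convert hl w.insertOne using 1
    funext N θ
    rw [← series_one_mul w (norm_circlePoint_lt_one N θ)]
    simp only [Pi.mul_apply, seriesOrOne]
    ring

lemma logSineApprox_mul_mem_innerSpan {Φ : ℕ → ℝ → ℂ} (hΦ : Φ ∈ innerSpan) :
    (fun N (θ : ℝ) => logSineApprox N θ * Φ N θ) ∈ innerSpan := by
  have h := sub_mem (Submodule.smul_mem _ gaussianI (Submodule.smul_mem _ (2⁻¹ : ℚ⟮Complex.I⟯)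
    (sub_mem (pi_mul_mem_innerSpan hΦ) (mul_mem_innerSpan hΦ)))) (series_one_mul_mem_innerSpan hΦ)
  convert h using 1
  funext N θ
  have h2 (z : ℂ) : (2⁻¹ : ℚ⟮Complex.I⟯) • z = 2⁻¹ * z := by
    rw [IntermediateField.smul_def, smul_eq_mul, IntermediateField.coe_inv]
    rfl
  simp only [Pi.sub_apply, Pi.smul_apply, gaussianI_smul, h2, logSineApprox]
  ring

lemma logSineApprox_pow_mul_mem_innerSpan (p : ℕ) {Φ : ℕ → ℝ → ℂ} (hΦ : Φ ∈ innerSpan) :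
    (fun N (θ : ℝ) => logSineApprox N θ ^ p * Φ N θ) ∈ innerSpan := by
  induction p with
  | zero => simpa using hΦ
  | succ p ih =>
    convert logSineApprox_mul_mem_innerSpan ih using 1
    funext N θ
    ring

lemma shift_mul_mem_innerSpan (m : ℕ) {Φ : ℕ → ℝ → ℂ} (hΦ : Φ ∈ innerSpan) :
    (fun N (θ : ℝ) => ((2 * m * Real.pi + θ : ℝ) : ℂ) * Φ N θ) ∈ innerSpan := by
  convert add_mem (nsmul_mem (pi_mul_mem_innerSpan hΦ) (2 * m)) (mul_mem_innerSpan hΦ) using 1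
  funext N θ
  simp only [Pi.add_apply, Pi.smul_apply]
  rw [nsmul_eq_mul]
  push_cast
  ring

lemma shift_pow_mul_mem_innerSpan (m l : ℕ) {Φ : ℕ → ℝ → ℂ} (hΦ : Φ ∈ innerSpan) :
    (fun N (θ : ℝ) => ((2 * m * Real.pi + θ : ℝ) : ℂ) ^ l * Φ N θ) ∈ innerSpan := by
  induction l with
  | zero => simpa using hΦ
  | succ l ih =>
    convert shift_mul_mem_innerSpan m ih using 1
    funext N θ
    ring

lemma continuous_of_mem_innerSpan {Φ : ℕ → ℝ → ℂ} (hΦ : Φ ∈ innerSpan) (N : ℕ) :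
    Continuous (Φ N) := by
  induction hΦ using Submodule.span_induction with
  | mem Φ h =>
    obtain ⟨a, b, zs, o, rfl⟩ := h
    have : Continuous fun θ : ℝ => seriesOrOne o (circlePoint N θ) := by
      cases o with
      | none => exact continuous_const
      | some w => exact continuous_series_circlePoint w N
    fun_prop
  | zero => exact continuous_const
  | add Φ Ψ _ _ h1 h2 => exact h1.add h2
  | smul c Φ _ h => exact continuous_const.mul h

/-! ### Integration inside the disc and passage to the boundary -/

/-- Induction on `a` by parts, with primitive `-i Li_{0w}(r_N e^{iθ})` of `Li_w(r_N e^{iθ})`. -/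
lemma exists_tendsto_integral_pow_mul_series (a : ℕ) (w : PolylogWord) :
    ∃ g ∈ boundarySpan, ∀ σ : ℝ, Tendsto
      (fun N => ∫ θ in (0 : ℝ)..σ, (θ : ℂ) ^ a * w.series (circlePoint N θ)) atTop (𝓝 (g σ)) := by
  have hmem (a : ℕ) (w : PolylogWord) : (fun σ : ℝ => (σ : ℂ) ^ a *
      (zero w).series (Complex.exp (Complex.I * σ))) ∈ boundarySpan := by
    simpa [zetaMonomial, seriesOrOne] using mem_boundarySpan a 0 [] (some w)
  have hparts (a : ℕ) (w : PolylogWord) (N : ℕ) (σ : ℝ) :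
      ∫ θ in (0 : ℝ)..σ, (θ : ℂ) ^ a * w.series (circlePoint N θ) =
        (σ : ℂ) ^ a * (-Complex.I * (zero w).series (circlePoint N σ)) -
          ((0 : ℝ) : ℂ) ^ a * (-Complex.I * (zero w).series (circlePoint N 0)) -
        ∫ θ in (0 : ℝ)..σ, (a * (θ : ℂ) ^ (a - 1)) *
          (-Complex.I * (zero w).series (circlePoint N θ)) := by
    refine intervalIntegral.integral_mul_deriv_eq_deriv_mul (u := fun θ : ℝ => (θ : ℂ) ^ a)
      (v := fun θ : ℝ => -Complex.I * (zero w).series (circlePoint N θ))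
      (fun θ _ => ?_) (fun θ _ => ?_) ?_ ?_
    · simpa using ((hasDerivAt_id (θ : ℂ)).pow a).comp_ofReal
    · refine ((hasDerivAt_series_zero w (radius_nonneg N) (radius_lt_one N) θ).const_mul
        (-Complex.I)).congr_deriv ?_
      rw [← mul_assoc, neg_mul, Complex.I_mul_I, neg_neg, one_mul]
      rfl
    · exact Continuous.intervalIntegrable (by fun_prop) _ _
    · exact (continuous_series_circlePoint w N).intervalIntegrable _ _
  induction a generalizing w with
  | zero =>
    obtain ⟨h, -, hz⟩ := exists_admissibleIndex w
    have hconst : (fun _ : ℝ => (zero w).series 1) ∈ boundarySpan := by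
      simpa [zetaMonomial, seriesOrOne, hz] using mem_boundarySpan 0 0 [h] none
    refine ⟨_, Submodule.smul_mem _ gaussianI (sub_mem hconst (hmem 0 w)), fun σ => ?_⟩
    simp_rw [hparts]
    have t1 := tendsto_series_zero_circlePoint w σ
    have t0 := tendsto_series_zero_circlePoint w 0
    have t := (t0.sub t1).const_mul Complex.I
    simp only [Complex.ofReal_zero, mul_zero, Complex.exp_zero] at t
    simp only [Pi.smul_apply, Pi.sub_apply, gaussianI_smul, pow_zero, one_mul]
    refine t.congr fun N => ?_
    simp
    ring
  | succ a ih =>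
    obtain ⟨g, hg, ht⟩ := ih (zero w)
    refine ⟨_, Submodule.smul_mem _ gaussianI (sub_mem (nsmul_mem hg (a + 1)) (hmem (a + 1) w)),
      fun σ => ?_⟩
    simp_rw [hparts]
    have t := (((ht σ).const_mul ((a + 1 : ℕ) : ℂ)).sub
      ((tendsto_series_zero_circlePoint w σ).const_mul ((σ : ℂ) ^ (a + 1)))).const_mul Complex.I
    simp only [Pi.smul_apply, Pi.sub_apply, gaussianI_smul]
    rw [nsmul_eq_mul]
    refine t.congr fun N => ?_
    have hI : ∫ θ in (0 : ℝ)..σ, (((a + 1 : ℕ) : ℂ) * (θ : ℂ) ^ (a + 1 - 1)) *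
        (-Complex.I * (zero w).series (circlePoint N θ)) = (-Complex.I * (a + 1 : ℕ)) *
          ∫ θ in (0 : ℝ)..σ, (θ : ℂ) ^ a * (zero w).series (circlePoint N θ) := by
      rw [← intervalIntegral.integral_const_mul]
      congr 1
      funext θ
      rw [Nat.add_sub_cancel]
      ring
    rw [hI, Complex.ofReal_zero, zero_pow a.succ_ne_zero]
    ring

lemma exists_tendsto_integral_of_mem_innerSpan {Φ : ℕ → ℝ → ℂ} (hΦ : Φ ∈ innerSpan) :
    ∃ g ∈ boundarySpan, ∀ σ : ℝ,
      Tendsto (fun N => ∫ θ in (0 : ℝ)..σ, Φ N θ) atTop (𝓝 (g σ)) := by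
  induction hΦ using Submodule.span_induction with
  | mem Φ h =>
    obtain ⟨a, b, zs, o, rfl⟩ := h
    have hc (N : ℕ) (σ : ℝ) : ∫ θ in (0 : ℝ)..σ, (θ : ℂ) ^ a * zetaMonomial b zs *
        seriesOrOne o (circlePoint N θ) =
        zetaMonomial b zs * ∫ θ in (0 : ℝ)..σ, (θ : ℂ) ^ a * seriesOrOne o (circlePoint N θ) := by
      rw [← intervalIntegral.integral_const_mul]
      congr 1
      funext θ
      ring
    simp_rw [hc]
    cases o with
    | none =>
      refine ⟨_, Submodule.smul_mem _ ((a + 1 : ℚ⟮Complex.I⟯)⁻¹) (mem_boundarySpan (a + 1) b zs none),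
        fun σ => ?_⟩
      have hint : ∫ θ in (0 : ℝ)..σ, (θ : ℂ) ^ a = (σ : ℂ) ^ (a + 1) / (a + 1) := by
        have := integral_pow (a := 0) (b := σ) a
        rw [zero_pow a.succ_ne_zero, sub_zero] at this
        have h2 := congrArg (fun x : ℝ => (x : ℂ)) this
        simp only [← intervalIntegral.integral_ofReal] at h2
        push_cast at h2
        exact h2
      simp only [seriesOrOne, mul_one, hint, Pi.smul_apply, Option.map_none]
      convert tendsto_const_nhds using 2
      rw [IntermediateField.smul_def, smul_eq_mul]
      push_cast
      ring
    | some w =>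
      obtain ⟨g, hg, ht⟩ := exists_tendsto_integral_pow_mul_series a w
      refine ⟨_, monomial_mul_mem_boundarySpan 0 b zs hg, fun σ => ?_⟩
      simpa [seriesOrOne] using (ht σ).const_mul (zetaMonomial b zs)
  | zero => exact ⟨0, zero_mem _, fun σ => by simp⟩
  | add Φ Ψ hΦ hΨ h1 h2 =>
    obtain ⟨g1, hg1, t1⟩ := h1
    obtain ⟨g2, hg2, t2⟩ := h2
    refine ⟨_, add_mem hg1 hg2, fun σ => ((t1 σ).add (t2 σ)).congr fun N => ?_⟩
    exact (intervalIntegral.integral_add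
      ((continuous_of_mem_innerSpan hΦ N).intervalIntegrable _ _)
      ((continuous_of_mem_innerSpan hΨ N).intervalIntegrable _ _)).symm
  | smul c Φ hΦ h =>
    obtain ⟨g, hg, t⟩ := h
    refine ⟨_, Submodule.smul_mem _ c hg, fun σ => ((t σ).const_mul (c : ℂ)).congr fun N => ?_⟩
    exact (intervalIntegral.integral_const_mul _ _).symm

/-- Moving from `e^{iθ}` to `r_N e^{iθ}` approximates boundary functions by functions inside the
disc, boundedly on `[0, 2π]`. -/
lemma exists_innerSpan_approximation {f : ℝ → ℂ} (hf : f ∈ boundarySpan) :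
    ∃ Φ ∈ innerSpan, (∃ C : ℝ, ∀ N, ∀ θ ∈ Set.Icc (0 : ℝ) (2 * Real.pi), ‖Φ N θ‖ ≤ C) ∧
      ∀ θ, Tendsto (fun N => Φ N θ) atTop (𝓝 (f θ)) := by
  induction hf using Submodule.span_induction with
  | mem f h =>
    obtain ⟨a, b, zs, o, rfl⟩ := h
    refine ⟨_, mem_innerSpan a b zs (o.map zero), ?_, fun θ => ?_⟩
    · have ho : ∃ D : ℝ, ∀ N θ, ‖seriesOrOne (o.map zero) (circlePoint N θ)‖ ≤ D := by
        cases o with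
        | none => exact ⟨1, fun N θ => by simp [seriesOrOne]⟩
        | some w => exact ⟨_, fun N θ => norm_series_zero_le w (norm_circlePoint_lt_one N θ).le⟩
      obtain ⟨D, hD⟩ := ho
      refine ⟨(2 * Real.pi) ^ a * ‖zetaMonomial b zs‖ * D, fun N θ hθ => ?_⟩
      rw [norm_mul, norm_mul, norm_pow, Complex.norm_real, Real.norm_of_nonneg hθ.1]
      have := hθ.2
      have := hθ.1
      gcongr
      exact hD N θ
    · refine Tendsto.const_mul _ ?_
      cases o with
      | none => exact tendsto_const_nhds
      | some w => exact tendsto_series_zero_circlePoint w θ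
  | zero => exact ⟨0, zero_mem _, ⟨0, fun N θ _ => by simp⟩, fun θ => tendsto_const_nhds⟩
  | add f g _ _ h1 h2 =>
    obtain ⟨Φ, hΦ, ⟨C, hC⟩, tΦ⟩ := h1
    obtain ⟨Ψ, hΨ, ⟨D, hD⟩, tΨ⟩ := h2
    exact ⟨_, add_mem hΦ hΨ, ⟨C + D, fun N θ hθ => norm_add_le_of_le (hC N θ hθ) (hD N θ hθ)⟩,
      fun θ => (tΦ θ).add (tΨ θ)⟩
  | smul c f _ h =>
    obtain ⟨Φ, hΦ, ⟨C, hC⟩, tΦ⟩ := h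
    refine ⟨_, Submodule.smul_mem _ c hΦ, ⟨‖(c : ℂ)‖ * C, fun N θ hθ => ?_⟩,
      fun θ => (tΦ θ).const_mul (c : ℂ)⟩
    exact (norm_mul (c : ℂ) (Φ N θ)).trans_le (by gcongr; exact hC N θ hθ)

/-- The key closure property: `boundarySpan` is stable under one step of the iterated log-sine
integral, also when the integration starts at `2mπ`. -/
lemma exists_boundarySpan_integral {f : ℝ → ℂ} (hf : f ∈ boundarySpan) (m l p : ℕ) :
    ∃ g ∈ boundarySpan, ∀ σ ∈ Set.Icc (0 : ℝ) (2 * Real.pi),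
      ∫ θ in (0 : ℝ)..σ, ((2 * m * Real.pi + θ : ℝ) : ℂ) ^ l * ((logSineA θ : ℂ) ^ p * f θ) =
        g σ := by
  obtain ⟨Φ, hΦ, ⟨C, hC⟩, tΦ⟩ := exists_innerSpan_approximation hf
  have hΨ := shift_pow_mul_mem_innerSpan m l (logSineApprox_pow_mul_mem_innerSpan p hΦ)
  obtain ⟨g, hg, tg⟩ := exists_tendsto_integral_of_mem_innerSpan hΨ
  refine ⟨g, hg, fun σ hσ => tendsto_nhds_unique ?_ (tg σ)⟩
  have hC0 : 0 ≤ C := (norm_nonneg _).trans (hC 0 0 ⟨le_rfl, by positivity⟩)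
  set R : ℝ := 2 * m * Real.pi + 2 * Real.pi with hR
  -- The endpoint `2π`, where the kernel is singular, is discarded as a null set.
  have hlt : ∀ᵐ θ : ℝ, θ ∈ Set.uIoc 0 σ → 0 < θ ∧ θ < 2 * Real.pi := by
    filter_upwards [Measure.ae_ne volume (2 * Real.pi)] with θ hne hθ
    rw [Set.uIoc_of_le hσ.1] at hθ
    exact ⟨hθ.1, lt_of_le_of_ne (hθ.2.trans hσ.2) hne⟩
  refine intervalIntegral.tendsto_integral_filter_of_dominated_convergence
    (fun θ => R ^ l * (2 ^ (p - 1) * (|logSineA θ| ^ p + 10 ^ p) * C)) ?_ ?_ ?_ ?_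
  · exact Eventually.of_forall fun N =>
      (continuous_of_mem_innerSpan hΨ N).aestronglyMeasurable
  · refine Eventually.of_forall fun N => ?_
    filter_upwards [hlt] with θ h hθ
    obtain ⟨h0, h1⟩ := h hθ
    rw [norm_mul, norm_mul, norm_pow, norm_pow, Complex.norm_real,
      Real.norm_of_nonneg (by positivity)]
    have hA := norm_logSineApprox_le N h0 h1
    have hp := add_pow_le (abs_nonneg (logSineA θ)) (by norm_num : (0 : ℝ) ≤ 10) p
    gcongr
    · linarith
    · exact (pow_le_pow_left₀ (norm_nonneg _) hA p).trans hp
    · exact hC N θ ⟨h0.le, h1.le⟩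
  · exact ((((intervalIntegrable_abs_logSineA_pow p 0 σ).add
      intervalIntegrable_const).const_mul _).mul_const _).const_mul _
  · filter_upwards [hlt] with θ h hθ
    obtain ⟨h0, h1⟩ := h hθ
    exact (((tendsto_logSineApprox h0 h1).pow p).mul (tΦ θ)).const_mul _

/-- The value at the right end `2π`, which starts the integration over the next period, is again in
the span: a generator takes there the value `2^a π^(a + b)` times multiple zeta values. -/
lemma const_mem_boundarySpan {f : ℝ → ℂ} (hf : f ∈ boundarySpan) :
    (fun _ : ℝ => f (2 * Real.pi)) ∈ boundarySpan := by
  induction hf using Submodule.span_induction with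
  | mem f h =>
    obtain ⟨a, b, zs, o, rfl⟩ := h
    have he : Complex.exp (Complex.I * (2 * Real.pi : ℝ)) = 1 := by
      rw [mul_comm]; push_cast; exact Complex.exp_two_pi_mul_I
    have ho : ∃ zs', seriesOrOne (o.map zero) 1 = zetaMonomial 0 zs' := by
      cases o with
      | none => exact ⟨[], by simp [zetaMonomial, seriesOrOne]⟩
      | some w =>
        obtain ⟨h, -, hz⟩ := exists_admissibleIndex w
        exact ⟨[h], by simp [zetaMonomial, seriesOrOne, hz]⟩
    obtain ⟨zs', ho⟩ := ho
    convert nsmul_mem (mem_boundarySpan 0 (a + b) (zs ++ zs') none) (2 ^ a) using 1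
    funext θ
    simp only [he, ho, Pi.smul_apply, Option.map_none]
    simp only [seriesOrOne, zetaMonomial, List.map_append, List.prod_append]
    rw [nsmul_eq_mul]
    push_cast
    ring
  | zero => exact zero_mem _
  | add f g _ _ h1 h2 => exact add_mem h1 h2
  | smul c f _ h => exact Submodule.smul_mem _ c h

/-! ### Iterated log-sine integrals -/

lemma continuous_iteratedIntegral (n : ℕ) (l p : Fin n → ℕ) :
    Continuous (iteratedIntegral n fun u θ => θ ^ l u * logSineA θ ^ p u) := by
  induction n with
  | zero => exact continuous_const
  | succ n ih =>
    refine intervalIntegral.continuous_primitive (fun a b => ?_) 0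
    have := intervalIntegrable_continuous_mul_logSineA_pow
      ((continuous_pow (l (Fin.last n))).mul (ih (Fin.init l) (Fin.init p))) (p (Fin.last n)) a b
    refine this.congr fun θ _ => ?_
    simp only [Fin.init_def, Pi.mul_apply]
    ring

lemma exists_boundarySpan_iteratedIntegral (n : ℕ) (l p : Fin n → ℕ) (m : ℕ) :
    ∃ g ∈ boundarySpan, ∀ σ ∈ Set.Icc (0 : ℝ) (2 * Real.pi),
      (iteratedIntegral n (fun u θ => θ ^ l u * logSineA θ ^ p u) (2 * m * Real.pi + σ) : ℂ) =
        g σ := by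
  induction n generalizing m with
  | zero =>
    refine ⟨_, mem_boundarySpan 0 0 [] none, fun σ _ => ?_⟩
    simp [iteratedIntegral, zetaMonomial, seriesOrOne]
  | succ n ih =>
    set F := iteratedIntegral (n + 1) fun u θ => θ ^ l u * logSineA θ ^ p u with hF
    set G := iteratedIntegral n fun u θ => θ ^ Fin.init l u * logSineA θ ^ Fin.init p u with hG
    have hFG (x : ℝ) : F x = ∫ θ in (0 : ℝ)..x,
        θ ^ l (Fin.last n) * logSineA θ ^ p (Fin.last n) * G θ := rfl
    have hint (a b : ℝ) : IntervalIntegrable (fun θ => θ ^ l (Fin.last n) *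
        logSineA θ ^ p (Fin.last n) * G θ) volume a b := by
      have := intervalIntegrable_continuous_mul_logSineA_pow
        ((continuous_pow (l (Fin.last n))).mul (continuous_iteratedIntegral n (Fin.init l)
          (Fin.init p))) (p (Fin.last n)) a b
      refine this.congr fun θ _ => ?_
      simp only [hG, Pi.mul_apply]
      ring
    have hshift (m : ℕ) (σ : ℝ) : F (2 * m * Real.pi + σ) = F (2 * m * Real.pi) +
        ∫ θ in (0 : ℝ)..σ, (2 * m * Real.pi + θ) ^ l (Fin.last n) *
          (logSineA θ ^ p (Fin.last n) * G (2 * m * Real.pi + θ)) := by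
      rw [hFG, hFG, ← intervalIntegral.integral_add_adjacent_intervals (hint 0 _)
        (hint (2 * m * Real.pi) (2 * m * Real.pi + σ))]
      congr 1
      have := intervalIntegral.integral_comp_add_left (a := 0) (b := σ)
        (fun θ => θ ^ l (Fin.last n) * logSineA θ ^ p (Fin.last n) * G θ) (2 * m * Real.pi)
      rw [add_zero] at this
      rw [← this]
      congr 1
      funext θ
      rw [logSineA_add_nat_mul]
      ring
    have hstep (m : ℕ) (hc : (fun _ : ℝ => (F (2 * m * Real.pi) : ℂ)) ∈ boundarySpan) :
        ∃ g ∈ boundarySpan, ∀ σ ∈ Set.Icc (0 : ℝ) (2 * Real.pi),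
          (F (2 * m * Real.pi + σ) : ℂ) = g σ := by
      obtain ⟨f, hf, hfG⟩ := ih (Fin.init l) (Fin.init p) m
      obtain ⟨g, hg, hgf⟩ := exists_boundarySpan_integral hf m (l (Fin.last n)) (p (Fin.last n))
      refine ⟨_, add_mem hc hg, fun σ hσ => ?_⟩
      rw [hshift, Pi.add_apply, ← hgf σ hσ, Complex.ofReal_add, ← intervalIntegral.integral_ofReal]
      congr 1
      refine intervalIntegral.integral_congr fun θ hθ => ?_
      rw [Set.uIcc_of_le hσ.1] at hθ
      rw [← hfG θ ⟨hθ.1, hθ.2.trans hσ.2⟩]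
      push_cast
      rfl
    -- The start value `F (2mπ)` is the value at `σ = 2π` of the preceding period.
    have hconst (m : ℕ) : (fun _ : ℝ => (F (2 * m * Real.pi) : ℂ)) ∈ boundarySpan := by
      induction m with
      | zero =>
        have : F (2 * (0 : ℕ) * Real.pi) = 0 := by simp [hFG]
        rw [this, Complex.ofReal_zero]
        exact zero_mem _
      | succ m ihm =>
        obtain ⟨g, hg, hgF⟩ := hstep m ihm
        have := hgF (2 * Real.pi) ⟨by positivity, le_rfl⟩
        have e : 2 * ((m + 1 : ℕ) : ℝ) * Real.pi = 2 * m * Real.pi + 2 * Real.pi := by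
          push_cast; ring
        rw [e, this]
        exact const_mem_boundarySpan hg
    exact hstep m (hconst m)

/-- The kernel is even and a power of `θ` is even or odd, so reflection changes at most the sign. -/
lemma exists_iteratedIntegral_neg (n : ℕ) (l p : Fin n → ℕ) : ∃ e : ℕ, ∀ x : ℝ,
    iteratedIntegral n (fun u θ => θ ^ l u * logSineA θ ^ p u) (-x) =
      (-1) ^ e * iteratedIntegral n (fun u θ => θ ^ l u * logSineA θ ^ p u) x := by
  induction n with
  | zero => exact ⟨0, fun x => by simp [iteratedIntegral]⟩
  | succ n ih =>
    obtain ⟨e, he⟩ := ih (Fin.init l) (Fin.init p)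
    refine ⟨l (Fin.last n) + e + 1, fun x => ?_⟩
    set G := iteratedIntegral n fun u θ => θ ^ Fin.init l u * logSineA θ ^ Fin.init p u with hG
    change ∫ θ in (0 : ℝ)..(-x), θ ^ l (Fin.last n) * logSineA θ ^ p (Fin.last n) * G θ =
      (-1) ^ (l (Fin.last n) + e + 1) * ∫ θ in (0 : ℝ)..x,
        θ ^ l (Fin.last n) * logSineA θ ^ p (Fin.last n) * G θ
    have h := intervalIntegral.integral_comp_neg (a := x) (b := 0)
      (fun θ => θ ^ l (Fin.last n) * logSineA θ ^ p (Fin.last n) * G θ)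
    rw [neg_zero] at h
    rw [← h, intervalIntegral.integral_symm, pow_succ, mul_neg_one, neg_mul,
      ← intervalIntegral.integral_const_mul]
    congr 2
    funext θ
    rw [logSineA_neg, he, neg_pow, pow_add]
    ring

/-- Restriction to `[0, 2π]` turns words back into admissible indices. -/
lemma restrict_mem_logSineSpan {f : ℝ → ℂ} (hf : f ∈ boundarySpan) :
    (fun σ : Set.Icc (0 : ℝ) (2 * Real.pi) => f σ) ∈ logSineSpan := by
  induction hf using Submodule.span_induction with
  | mem f h =>
    obtain ⟨a, b, zs, o, rfl⟩ := h
    cases o with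
    | none =>
      refine Submodule.subset_span ⟨a, b, zs, [], ?_⟩
      funext σ
      simp [logSineProduct, zetaMonomial, seriesOrOne, mul_assoc]
    | some w =>
      obtain ⟨h, hh, -⟩ := exists_admissibleIndex w
      refine Submodule.subset_span ⟨a, b, zs, [h], ?_⟩
      funext σ
      have := hh (Complex.exp (Complex.I * ((σ : ℝ) : ℂ))) (Complex.norm_exp_I_mul_ofReal _).le
      simp [logSineProduct, zetaMonomial, seriesOrOne, mul_assoc, this]
  | zero => exact zero_mem _
  | add f g _ _ h1 h2 => exact add_mem h1 h2
  | smul c f _ h => exact Submodule.smul_mem _ c h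

lemma restrict_mem_of_eqOn {f g : ℝ → ℂ} (hg : g ∈ boundarySpan)
    (h : ∀ σ ∈ Set.Icc (0 : ℝ) (2 * Real.pi), f σ = g σ) :
    (fun σ : Set.Icc (0 : ℝ) (2 * Real.pi) => f σ) ∈ logSineSpan := by
  rw [show (fun σ : Set.Icc (0 : ℝ) (2 * Real.pi) => f σ) = fun σ : Set.Icc _ _ => g σ from
    funext fun σ => h σ σ.2]
  exact restrict_mem_logSineSpan hg

/-! ### Values at multiples of `2π` -/

/-- The `ℚ`-subalgebra of `ℂ` generated by `i`, `π` and the multiple zeta values. -/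
def complexZetaAlgebra : Subalgebra ℚ ℂ :=
  Algebra.adjoin ℚ (insert Complex.I (Complex.ofReal '' insert Real.pi (Set.range multipleZeta)))

lemma coe_mem_complexZetaAlgebra (c : ℚ⟮Complex.I⟯) : (c : ℂ) ∈ complexZetaAlgebra := by
  have hI : IsAlgebraic ℚ Complex.I :=
    ⟨Polynomial.X ^ 2 + 1, by
      intro h
      have := congrArg (Polynomial.eval 0) h
      simp at this, by simp⟩
  have h : (c : ℂ) ∈ (ℚ⟮Complex.I⟯).toSubalgebra := c.2
  rw [IntermediateField.adjoin_simple_toSubalgebra_of_isAlgebraic hI] at h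
  exact Algebra.adjoin_mono (by simp) h

lemma re_im_mem_of_mem_complexZetaAlgebra {z : ℂ} (hz : z ∈ complexZetaAlgebra) :
    z.re ∈ Algebra.adjoin ℚ (insert Real.pi (Set.range multipleZeta)) ∧
      z.im ∈ Algebra.adjoin ℚ (insert Real.pi (Set.range multipleZeta)) := by
  induction hz using Algebra.adjoin_induction with
  | mem z h =>
    rcases h with rfl | ⟨x, hx, rfl⟩
    · simp [zero_mem, one_mem]
    · exact ⟨Algebra.subset_adjoin hx, by simp [zero_mem]⟩
  | algebraMap r =>
    have : algebraMap ℚ ℂ r = ((algebraMap ℚ ℝ r : ℝ) : ℂ) := by simp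
    rw [this]
    exact ⟨Subalgebra.algebraMap_mem _ r, by rw [Complex.ofReal_im]; exact zero_mem _⟩
  | add x y _ _ hx hy => exact ⟨add_mem hx.1 hy.1, add_mem hx.2 hy.2⟩
  | mul x y _ _ hx hy =>
    exact ⟨sub_mem (mul_mem hx.1 hy.1) (mul_mem hx.2 hy.2),
      add_mem (mul_mem hx.1 hy.2) (mul_mem hx.2 hy.1)⟩

lemma zetaMonomial_mem (b : ℕ) (zs : List AdmissibleIndex) :
    zetaMonomial b zs ∈ complexZetaAlgebra := by
  refine mul_mem (pow_mem (Algebra.subset_adjoin (by simp)) b) (list_prod_mem fun x hx => ?_)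
  obtain ⟨k, -, rfl⟩ := List.mem_map.1 hx
  exact Algebra.subset_adjoin (by simp)

lemma apply_zero_mem_of_mem_boundarySpan {f : ℝ → ℂ} (hf : f ∈ boundarySpan) :
    f 0 ∈ complexZetaAlgebra := by
  induction hf using Submodule.span_induction with
  | mem f h =>
    obtain ⟨a, b, zs, o, rfl⟩ := h
    refine mul_mem (mul_mem (pow_mem (by simp [zero_mem]) a) (zetaMonomial_mem b zs)) ?_
    rw [Complex.ofReal_zero, mul_zero, Complex.exp_zero]
    cases o with
    | none => exact one_mem _
    | some w =>
      obtain ⟨h, -, hz⟩ := exists_admissibleIndex w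
      rw [Option.map_some, seriesOrOne, ← hz]
      exact Algebra.subset_adjoin (by simp)
  | zero => exact zero_mem _
  | add f g _ _ h1 h2 => exact add_mem h1 h2
  | smul c f _ h => exact mul_mem (coe_mem_complexZetaAlgebra c) h

end

theorem mainTheorem2 (n : ℕ) (k l : Fin n → ℕ)
    (hkl : ∀ u, 0 ≤ (k u : ℤ) - 1 - (l u : ℤ)) :
    (∀ m : ℕ,
      (fun σ : Set.Icc (0 : ℝ) (2 * Real.pi) =>
        (iteratedLogSine k l (2 * m * Real.pi + σ) : ℂ)) ∈ logSineSpan ∧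
      (fun σ : Set.Icc (0 : ℝ) (2 * Real.pi) =>
        (iteratedLogSine k l (-(2 * m * Real.pi + σ)) : ℂ)) ∈ logSineSpan) ∧
    (∀ m : ℤ,
      iteratedLogSine k l (2 * m * Real.pi) ∈
        Algebra.adjoin ℚ (insert Real.pi (Set.range multipleZeta))) := by
  choose p hp using fun u => Int.eq_ofNat_of_zero_le (hkl u)
  have hLs (x : ℝ) : iteratedLogSine k l x =
      (-1) ^ n * iteratedIntegral n (fun u θ => θ ^ l u * logSineA θ ^ p u) x := by
    simp only [iteratedLogSine, hp, zpow_natCast]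
  obtain ⟨e, he⟩ := exists_iteratedIntegral_neg n l p
  have key (s m : ℕ) : ∃ g ∈ boundarySpan, ∀ σ ∈ Set.Icc (0 : ℝ) (2 * Real.pi),
      (((-1) ^ s * iteratedIntegral n (fun u θ => θ ^ l u * logSineA θ ^ p u)
        (2 * m * Real.pi + σ) : ℝ) : ℂ) = g σ := by
    obtain ⟨g, hg, h⟩ := exists_boundarySpan_iteratedIntegral n l p m
    refine ⟨_, zsmul_mem hg ((-1) ^ s), fun σ hσ => ?_⟩
    rw [Complex.ofReal_mul, h σ hσ]
    simp
  have hpos (m : ℕ) : ∃ g ∈ boundarySpan, ∀ σ ∈ Set.Icc (0 : ℝ) (2 * Real.pi),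
      (iteratedLogSine k l (2 * m * Real.pi + σ) : ℂ) = g σ := by
    simpa only [hLs] using key n m
  have hneg (m : ℕ) : ∃ g ∈ boundarySpan, ∀ σ ∈ Set.Icc (0 : ℝ) (2 * Real.pi),
      (iteratedLogSine k l (-(2 * m * Real.pi + σ)) : ℂ) = g σ := by
    simpa only [hLs, he, ← mul_assoc, ← pow_add] using key (n + e) m
  have hvalue {g : ℝ → ℂ} (hg : g ∈ boundarySpan) {x : ℝ} (hx : (x : ℂ) = g 0) :
      x ∈ Algebra.adjoin ℚ (insert Real.pi (Set.range multipleZeta)) := by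
    have := (re_im_mem_of_mem_complexZetaAlgebra (apply_zero_mem_of_mem_boundarySpan hg)).1
    rwa [← hx, Complex.ofReal_re] at this
  have h0 : (0 : ℝ) ∈ Set.Icc (0 : ℝ) (2 * Real.pi) := ⟨le_rfl, by positivity⟩
  refine ⟨fun m => ⟨?_, ?_⟩, fun m => ?_⟩
  · obtain ⟨g, hg, h⟩ := hpos m
    exact restrict_mem_of_eqOn (f := fun σ => (iteratedLogSine k l (2 * m * Real.pi + σ) : ℂ)) hg h
  · obtain ⟨g, hg, h⟩ := hneg m
    exact restrict_mem_of_eqOn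
      (f := fun σ => (iteratedLogSine k l (-(2 * m * Real.pi + σ)) : ℂ)) hg h
  · obtain ⟨j, rfl | rfl⟩ := m.eq_nat_or_neg
    · obtain ⟨g, hg, h⟩ := hpos j
      refine hvalue hg ?_
      simpa using h 0 h0
    · obtain ⟨g, hg, h⟩ := hneg j
      refine hvalue hg ?_
      simpa using h 0 h0
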